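/- Let $G$ be a finite undirected multigraph (loops and multiple edges allowed, not necessarily connected) with distinct vertices $s\neq t$, such that the graph $\overline G$ obtained from $G$ by adding an extra edge with ends $s,t$, labelled $\emptyset$, is planar; fix a planar embedding of $\overline G$. (An embedding is described combinatorially: by the cyclic order of the half-edges around each vertex, the face to the left of each half-edge and the face containing each isolated vertex, consistent along face boundaries, with connected vertex–face incidence and satisfying Euler's formula $|V|-|E|+|F|=1+C$, where $F$ is the set of faces and $C$ is the number of connected components.) Let $\overline G^\dagger$ be the planar dual of $\overline G$: its vertices are the faces of $\overline G$, and every edge $e$ of $\overline G$ has a dual edge $e^\dagger$ joining the faces on its two sides. Let $s',t'$ be the ends of the dual $\emptyset^\dagger$ of the added edge, and let $G'$ be $\overline G^\dagger$ with the edge $\emptyset^\dagger$ removed. Let $c:E(G)\to\mathbb R_{>0}$ be a weight function, and put $c'(e^\dagger)=1/c(e)$ for $e\in E(G)$. For $x\in\{0,1\}^{E(G)}$ let $G(x)$ be the subgraph of $G$ with all vertices and the edges $e$ with $x_e=1$, and let $G'(x)$ be the subgraph of $G'$ with all vertices and the edges $e^\dagger$ with $x_e=0$. For a multigraph $K$ let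 $\overrightarrow E(K)$ be the set of directed edges $(u,v,\lambda)$, where $\lambda$ is an edge of $K$ with ends $u,v$. A unit flow from $a$ to $b$ in $K$ is a function $\theta:\overrightarrow E(K)\to\mathbb R$ with $\theta(u,v,\lambda)=-\theta(v,u,\lambda)$ whose net outflow $\sum_{(u,v,\lambda)\in\overrightarrow E(K)}\theta(u,v,\lambda)$ at each vertex $u$ is $[u=a]-[u=b]$. For positive edge weights $k$, the effective resistance $R_{a,b}(K,k)$ is the minimum of $\sum_{\lambda\in E(K)}\theta(u,v,\lambda)^2/k(\lambda)$ over all unit flows $\theta$ from $a$ to $b$ in $K$ if $a$ and $b$ are connected in $K$, and $\infty$ otherwise (thus $R_{a,a}(K,k)=0$). Let $P_{G,c}$ be the following span program on $\{0,1\}^{E(G)}$. Let $H$ be the real inner product space with orthonormal basis $\{|u,v,\lambda\rangle:(u,v,\lambda)\in\overrightarrow E(G)\}$, and for each edge $e$ let $H_{e,1}$ be the span of the basis vectors of the directed edges over $e$ and $H_{e,0}=\{0\}$. Let $U$ be the real vector space with basis $\{|u\rangle:u\in V(G)\}$, let $\tau=|s\rangle-|t\rangle$, and let $A=\sum_{(u,v,\lambda)\in\overrightarrow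 E(G)}\sqrt{c(\lambda)}\,(|u\rangle-|v\rangle)\langle u,v,\lambda|$. Put $H(x)=\bigoplus_e H_{e,x_e}$, with orthogonal projector $\Pi_{H(x)}$. The witness sizes are $$w_+(x,P_{G,c})=\min\{\|w\|^2: w\in H(x),\ Aw=\tau\},$$ $$w_-(x,P_{G,c})=\min\{\|\omega A\|^2:\ \omega:U\to\mathbb R\text{ linear},\ \omega A\Pi_{H(x)}=0,\ \omega\tau=1\},$$ where a minimum over the empty set is $\infty$. Then for every $x\in\{0,1\}^{E(G)}$, in $[0,\infty]$, $$w_+(x,P_{G,c})=\tfrac12\,R_{s,t}(G(x),c)\qquad\text{and}\qquad w_-(x,P_{G,c})=2\,R_{s',t'}(G'(x),c').$$ -/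

import Mathlib

open scoped Graph ENNReal

noncomputable section

namespace STConn

section Networks

variable {α β : Type*}

/-- The directed edges `(u, v, e)` of a multigraph: triples such that `e` is an edge with
ends `u` and `v`. -/
abbrev DirEdge (G : Graph α β) : Type _ :=
  {d : V(G) × V(G) × E(G) // G.IsLink d.2.2 d.1 d.2.1}

namespace DirEdge

variable {G : Graph α β}

def src (d : DirEdge G) : V(G) := d.1.1

def tgt (d : DirEdge G) : V(G) := d.1.2.1

def edge (d : DirEdge G) : E(G) := d.1.2.2

def rev (d : DirEdge G) : DirEdge G :=
  ⟨(d.tgt, d.src, d.edge), Graph.IsLink.symm d.2⟩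

/-- A directed edge over a given edge: one of its two orientations (chosen arbitrarily). -/
def ofEdge (e : E(G)) : DirEdge G :=
  let h := Graph.exists_isLink_of_mem_edgeSet e.2
  ⟨(⟨h.choose, h.choose_spec.choose_spec.left_mem⟩,
    ⟨h.choose_spec.choose, h.choose_spec.choose_spec.right_mem⟩, e),
    h.choose_spec.choose_spec⟩

end DirEdge

instance (G : Graph α β) [Finite α] [Finite β] : Fintype (DirEdge G) := Fintype.ofFinite _

instance (G : Graph α β) [Finite α] : Fintype V(G) := Fintype.ofFinite _

instance (G : Graph α β) [Finite β] : Fintype E(G) := Fintype.ofFinite _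

/-- The simple graph on the vertices of `G` in which distinct adjacent vertices are joined;
it has the same paths and connected components as `G`. -/
def adjGraph (G : Graph α β) : SimpleGraph V(G) :=
  SimpleGraph.fromRel fun u v => G.Adj u v

open Classical in
/-- Unit `st`-flows: antisymmetric functions on the directed edges whose net outflow is
`1` at `s`, `-1` at `t` and `0` at every other vertex. If `s = t` the net outflow is required to
be `0` everywhere. -/
structure IsUnitFlow (G : Graph α β) [Finite α] [Finite β] (s t : V(G))
    (θ : DirEdge G → ℝ) : Prop where
  antisymm : ∀ d, θ d = -θ d.rev
  outflow : ∀ u : V(G), ∑ d : DirEdge G with d.src = u, θ d =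
    (if u = s then 1 else 0) - (if u = t then 1 else 0)

/-- The energy `∑ θ(u,v,e)² / c(e)` of a flow, the sum being over the (undirected) edges.
By antisymmetry a term does not depend on the orientation in which the edge is read. -/
def flowEnergy (G : Graph α β) [Finite β] (c : β → ℝ) (θ : DirEdge G → ℝ) : ℝ :=
  ∑ e : E(G), θ (DirEdge.ofEdge e) ^ 2 / c e

open Classical in
/-- The effective resistance between `s` and `t` in the network `(G, c)`: the least energy of a
unit `st`-flow, and `∞` if `s` and `t` are not connected. Only the values of `c` on the edges of
`G` matter. -/
def effRes (G : Graph α β) [Finite α] [Finite β] (c : β → ℝ) (s t : V(G)) : ℝ≥0∞ :=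
  if (adjGraph G).Reachable s t then
    ⨅ (θ : DirEdge G → ℝ) (_ : IsUnitFlow G s t θ), ENNReal.ofReal (flowEnergy G c θ)
  else ⊤

end Networks

section SpanPrograms

/-- A span program on `{0,1}^ι`: a finite-dimensional inner product space `H`, the orthogonal
direct sum of subspaces `H_j`, with `H_{j,0} + H_{j,1} = H_j`, a vector space `U`, a nonzero
target `τ ∈ U` and a linear map `A : H → U`. -/
structure SpanProgram (ι H U : Type*) [NormedAddCommGroup H] [InnerProductSpace ℝ H]
    [FiniteDimensional ℝ H] [AddCommGroup U] [Module ℝ U] where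
  comp : ι → Submodule ℝ H
  orthogonal : OrthogonalFamily ℝ (fun j => comp j) fun j => (comp j).subtypeₗᵢ
  iSup_comp : ⨆ j, comp j = ⊤
  sub : ι → Bool → Submodule ℝ H
  sub_sup : ∀ j, sub j false ⊔ sub j true = comp j
  target : U
  target_ne_zero : target ≠ 0
  A : H →ₗ[ℝ] U

namespace SpanProgram

variable {ι H U : Type*} [NormedAddCommGroup H] [InnerProductSpace ℝ H]
  [FiniteDimensional ℝ H] [AddCommGroup U] [Module ℝ U]

/-- `H(x)`, the sum of the subspaces `H_{j,x_j}`. -/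
def space (P : SpanProgram ι H U) (x : ι → Bool) : Submodule ℝ H := ⨆ j, P.sub j (x j)

def IsPosWitness (P : SpanProgram ι H U) (x : ι → Bool) (w : H) : Prop :=
  w ∈ P.space x ∧ P.A w = P.target

/-- `ω` is a negative witness for `x`: `ω A Π_{H(x)} = 0` and `ω τ = 1`. -/
def IsNegWitness (P : SpanProgram ι H U) (x : ι → Bool) (ω : U →ₗ[ℝ] ℝ) : Prop :=
  ω ∘ₗ P.A ∘ₗ (P.space x).starProjection.toLinearMap = 0 ∧ ω P.target = 1

/-- The positive witness size; it is `∞` if there is no positive witness. -/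
def posSize (P : SpanProgram ι H U) (x : ι → Bool) : ℝ≥0∞ :=
  ⨅ (w : H) (_ : P.IsPosWitness x w), ENNReal.ofReal (‖w‖ ^ 2)

/-- The negative witness size, where `‖ω A‖` is the operator norm; it is `∞` if there is no
negative witness. -/
def negSize (P : SpanProgram ι H U) (x : ι → Bool) : ℝ≥0∞ :=
  ⨅ (ω : U →ₗ[ℝ] ℝ) (_ : P.IsNegWitness x ω),
    ENNReal.ofReal (‖LinearMap.toContinuousLinearMap (ω ∘ₗ P.A)‖ ^ 2)

end SpanProgram

end SpanPrograms

section GraphSpanProgram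

variable {α β : Type*}

open Classical in
/-- The span of the basis vectors `|u,v,e⟩`, `|v,u,e⟩` of the directed edges over `e`. -/
def edgeSpace (G : Graph α β) [Finite α] [Finite β] (e : E(G)) :
    Submodule ℝ (EuclideanSpace ℝ (DirEdge G)) :=
  Submodule.span ℝ ((fun d => EuclideanSpace.single d (1 : ℝ)) '' {d : DirEdge G | d.edge = e})

theorem edgeSpace_orthogonal (G : Graph α β) [Finite α] [Finite β] :
    OrthogonalFamily ℝ (fun e => edgeSpace G e) fun e => (edgeSpace G e).subtypeₗᵢ := by
  classical
  apply OrthogonalFamily.of_pairwise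
  intro e f hef
  change edgeSpace G e ⟂ edgeSpace G f
  unfold edgeSpace
  rw [Submodule.isOrtho_span]
  rintro _ ⟨d, hd, rfl⟩ _ ⟨d', hd', rfl⟩
  have hne : d ≠ d' := by
    rintro rfl
    exact hef (hd.symm.trans hd')
  simp [EuclideanSpace.inner_single_left, hne]

theorem iSup_edgeSpace (G : Graph α β) [Finite α] [Finite β] : ⨆ e, edgeSpace G e = ⊤ := by
  classical
  rw [eq_top_iff]
  intro w _
  rw [← (EuclideanSpace.basisFun (DirEdge G) ℝ).sum_repr w]
  refine Submodule.sum_mem _ fun d _ => Submodule.smul_mem _ _ ?_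
  refine Submodule.mem_iSup_of_mem d.edge (Submodule.subset_span ⟨d, rfl, ?_⟩)
  simp

theorem single_sub_single_ne_zero {G : Graph α β} {s t : V(G)} (hst : s ≠ t) :
    (Finsupp.single s (1 : ℝ) - Finsupp.single t 1 : V(G) →₀ ℝ) ≠ 0 := by
  rw [sub_ne_zero]
  intro h
  exact hst ((Finsupp.single_left_inj one_ne_zero).1 h)

/-- The `st`-connectivity span program `P_{G,c}` on `{0,1}^{E(G)}`. Here `U` is the vector space
with basis `|u⟩`, `u ∈ V(G)`, the target is `|s⟩ - |t⟩`, and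
`A = ∑ √c(e) (|u⟩ - |v⟩)⟨u,v,e|` over all directed edges. -/
def stProgram (G : Graph α β) [Finite α] [Finite β] (c : β → ℝ) (s t : V(G)) (hst : s ≠ t) :
    SpanProgram E(G) (EuclideanSpace ℝ (DirEdge G)) (V(G) →₀ ℝ) where
  comp := edgeSpace G
  orthogonal := edgeSpace_orthogonal G
  iSup_comp := iSup_edgeSpace G
  sub e b := if b then edgeSpace G e else ⊥
  sub_sup e := by simp
  target := Finsupp.single s 1 - Finsupp.single t 1
  target_ne_zero := single_sub_single_ne_zero hst
  A := ∑ d : DirEdge G, (EuclideanSpace.proj (𝕜 := ℝ) d).toLinearMap.smulRight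
    (Real.sqrt (c d.edge) • (Finsupp.single d.src 1 - Finsupp.single d.tgt 1))

end GraphSpanProgram

section Planar

variable {α β : Type*}

/-- The two half-edges of each edge; a loop has two half-edges as well. A half-edge is also read
as its edge directed away from the vertex at which the half-edge is attached. -/
abbrev HalfEdge (G : Graph α β) : Type _ := E(G) × Bool

namespace HalfEdge

variable {G : Graph α β}

/-- The other half of the same edge. -/
def flip (a : HalfEdge G) : HalfEdge G := (a.1, !a.2)

end HalfEdge

/-- An embedding of a finite multigraph `G`, connected or not, in the plane (equivalently, in the
sphere) with set of faces `F`, described combinatorially. The half-edges around each vertex are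
cyclically ordered by `rot` (clockwise), and `left a` is the face on the left of the half-edge `a`.
The walk that follows the boundary of a face keeping it on the left passes from `a` to
`rot a.flip`. An isolated vertex lies in one face. The last two fields say that the surface is the
sphere: it is connected, and Euler's formula `V - E + F = 1 + C` holds, where `C` is the number of
connected components of `G`. -/
structure PlaneEmbedding (G : Graph α β) (F : Type*) where
  /-- The vertex at which a half-edge is attached. -/
  tail : HalfEdge G → V(G)
  isLink_tail : ∀ a, G.IsLink a.1 (tail a) (tail a.flip)
  rot : Equiv.Perm (HalfEdge G)
  sameCycle_rot : ∀ a b, rot.SameCycle a b ↔ tail a = tail b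
  left : HalfEdge G → F
  left_rot_flip : ∀ a, left (rot a.flip) = left a
  /-- The face in which an isolated vertex lies. -/
  isolatedFace : {v : V(G) // ∀ a, tail a ≠ v} → F
  /-- The graph in which each vertex is joined to the faces that it touches is connected. -/
  connected : (SimpleGraph.fromRel fun p q : V(G) ⊕ F => ∃ v f, p = .inl v ∧ q = .inr f ∧
    ((∃ a, tail a = v ∧ left a = f) ∨ ∃ h, isolatedFace ⟨v, h⟩ = f)).Connected
  euler : Nat.card V(G) + Nat.card F =
    Nat.card E(G) + Nat.card (adjGraph G).ConnectedComponent + 1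

/-- The dual graph of an embedded graph: its vertices are the faces, and the edge `e` (which
keeps its label) joins the faces on the two sides of `e`. -/
def PlaneEmbedding.dual {G : Graph α β} {F : Type*} (M : PlaneEmbedding G F) : Graph F β where
  vertexSet := Set.univ
  edgeSet := E(G)
  IsLink e f g := ∃ h : e ∈ E(G), s(f, g) = s(M.left (⟨e, h⟩, false), M.left (⟨e, h⟩, true))
  isLink_symm e he := ⟨fun f g ⟨h, hfg⟩ => ⟨h, Sym2.eq_swap.trans hfg⟩⟩
  eq_or_eq_of_isLink_of_isLink := by
    rintro e x y v w ⟨h, hxy⟩ ⟨_, hvw⟩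
    have := hxy.trans hvw.symm
    rw [Sym2.eq_iff] at this
    tauto
  edge_mem_iff_exists_isLink e := ⟨fun h => ⟨_, _, h, rfl⟩, fun ⟨_, _, h, _⟩ => h⟩
  left_mem_of_isLink _ _ _ _ := Set.mem_univ _

/-- The graph `G` with an additional edge joining `s` and `t`, labelled `none`; an edge `e` of `G`
becomes `some e`. -/
def addEdge (G : Graph α β) (s t : V(G)) : Graph α (Option β) where
  vertexSet := V(G)
  IsLink o u v := match o with
    | none => s(u, v) = s(s.1, t.1)
    | some e => G.IsLink e u v
  isLink_symm o _ := ⟨fun u v h => by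
    cases o with
    | none => exact Sym2.eq_swap.trans h
    | some e => exact Graph.IsLink.symm h⟩
  eq_or_eq_of_isLink_of_isLink := by
    rintro (_ | e) x y v w h h'
    · have := h.trans h'.symm
      rw [Sym2.eq_iff] at this
      tauto
    · exact Graph.IsLink.left_eq_or_eq h h'
  left_mem_of_isLink := by
    rintro (_ | e) x y h
    · have h' : s(x, y) = s(s.1, t.1) := h
      rw [Sym2.eq_iff] at h'
      rcases h' with ⟨rfl, -⟩ | ⟨rfl, -⟩
      · exact s.2
      · exact t.2
    · exact Graph.IsLink.left_mem h

/-- A graph with labels in `Option β`, with the edge labelled `none` removed and each remaining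
label `some e` written as `e`. -/
def removeNone (K : Graph α (Option β)) : Graph α β where
  vertexSet := V(K)
  IsLink e u v := K.IsLink (some e) u v
  isLink_symm _ _ := ⟨fun _ _ h => Graph.IsLink.symm h⟩
  eq_or_eq_of_isLink_of_isLink _ _ _ _ _ h h' := Graph.IsLink.left_eq_or_eq h h'
  left_mem_of_isLink _ _ _ h := Graph.IsLink.left_mem h

/-- The graph `G'`: the dual of `G` plus an `st`-edge, with the dual of the `st`-edge removed. -/
def dualGraph {G : Graph α β} {s t : V(G)} {F : Type*} (M : PlaneEmbedding (addEdge G s t) F) :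
    Graph F β :=
  removeNone M.dual

/-- `G(x)`: all vertices of `G`, and the edges `e` with `x_e = 1`. -/
def inputGraph (G : Graph α β) (x : E(G) → Bool) : Graph α β :=
  G.restrict {e | ∃ h : e ∈ E(G), x ⟨e, h⟩ = true}

/-- `G'(x)`: all vertices of `G'`, and the dual edges of the edges `e` of `G` with `x_e = 0`. -/
def dualInputGraph {G : Graph α β} {s t : V(G)} {F : Type*}
    (M : PlaneEmbedding (addEdge G s t) F) (x : E(G) → Bool) : Graph F β :=
  (dualGraph M).restrict {e | ∃ h : e ∈ E(G), x ⟨e, h⟩ = false}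

end Planar

end STConn

end

/-! Both witness sizes are infima, and each identity comes from turning the feasible points of one
side into feasible points of the other without raising the cost beyond the stated factor. The
infinite cases need no separate treatment: an infimum over no feasible points is `⊤` on either side.

Positive side: `A w` is the net outflow of the flow √c(e)(w(d) - w(d.rev)), so `w` is a witness
exactly when this is a unit flow supported on `G(x)`. Among the vectors with a given flow, the
antisymmetric one has least norm, and its squared norm is half the energy
(`flowEnergy_vectorFlow_le`, `two_mul_norm_sq_flowVector`).

Negative side: a witness is a potential `f` on the vertices with f(s) - f(t) = 1, constant across
every edge with x_e = 1, and ‖ωA‖² is twice the sum of c(e)(Δf(e))² over the edges. In the edge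
space of the graph with the added edge, potential differences are orthogonal to face differences, by
summation along face boundaries. Euler's formula says that the two dimensions add up to the number
of edges, so the potential differences are exactly the circulations of the dual
(`exists_vertexDiff_eq`). The value ±1 of such a circulation on the added edge becomes, once that
edge is removed, a unit flow between s' and t'. Vanishing of Δf where x_e = 1 is support of the flow
on G'(x), and the dual weights 1/c make the energies match. -/

open scoped Graph ENNReal

namespace STConn

/-! ### Flows: orientations, energy and restriction to a set of edges -/

section Networks

variable {α β : Type*} {G : Graph α β}

namespace DirEdge

@[simp] theorem rev_rev (d : DirEdge G) : d.rev.rev = d := rfl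

@[simp] theorem src_rev (d : DirEdge G) : d.rev.src = d.tgt := rfl

@[simp] theorem tgt_rev (d : DirEdge G) : d.rev.tgt = d.src := rfl

@[simp] theorem edge_rev (d : DirEdge G) : d.rev.edge = d.edge := rfl

@[simp] theorem edge_ofEdge (e : E(G)) : (ofEdge e).edge = e := rfl

theorem isLink (d : DirEdge G) : G.IsLink d.edge d.src d.tgt := d.2

theorem ext {d d' : DirEdge G} (hs : d.src = d'.src) (ht : d.tgt = d'.tgt)
    (he : d.edge = d'.edge) : d = d' :=
  Subtype.ext (Prod.ext hs (Prod.ext ht he))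

def revEquiv : DirEdge G ≃ DirEdge G := ⟨rev, rev, rev_rev, rev_rev⟩

theorem eq_or_eq_rev {d d' : DirEdge G} (h : d.edge = d'.edge) : d = d' ∨ d = d'.rev := by
  have h1 := d.isLink
  have h2 := d'.isLink
  rw [h] at h1
  rcases h1.eq_and_eq_or_eq_and_eq h2 with ⟨a, b⟩ | ⟨a, b⟩
  · exact Or.inl (ext (Subtype.ext a) (Subtype.ext b) h)
  · exact Or.inr (ext (Subtype.ext a) (Subtype.ext b) h)

theorem rev_eq_self_iff {d : DirEdge G} : d.rev = d ↔ d.src = d.tgt :=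
  ⟨fun h => congrArg tgt h, fun h => ext h.symm h rfl⟩

variable [Finite α] [Finite β]

/-- A sum over directed edges, where loops contribute nothing, is a sum over edges of the terms
of the two orientations. -/
theorem sum_eq_sum_orientation (o : E(G) → DirEdge G) (ho : ∀ e, (o e).edge = e)
    (φ : DirEdge G → ℝ) (hφ : ∀ d, d.rev = d → φ d = 0) :
    ∑ d, φ d = ∑ e, (φ (o e) + φ (o e).rev) := by
  classical
  rw [← Finset.sum_fiberwise Finset.univ edge φ]
  refine Finset.sum_congr rfl fun e _ => ?_
  have hfib : Finset.univ.filter (fun d : DirEdge G => d.edge = e) = {o e, (o e).rev} := by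
    ext d
    simp only [Finset.mem_filter, Finset.mem_univ, true_and, Finset.mem_insert,
      Finset.mem_singleton]
    constructor
    · intro h
      exact eq_or_eq_rev (h.trans (ho e).symm)
    · rintro (rfl | rfl)
      · exact ho e
      · exact ho e
  rw [hfib]
  by_cases h : (o e).rev = o e
  · simp [h, hφ _ h]
  · rw [Finset.sum_pair (Ne.symm h)]

end DirEdge

/-- A loop has a single directed edge, its own reversal, so antisymmetry kills the flow there. -/
theorem eq_zero_of_rev_eq {θ : DirEdge G → ℝ} (hθ : ∀ d, θ d = -θ d.rev) (d : DirEdge G)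
    (h : d.rev = d) : θ d = 0 := by
  have := hθ d
  rw [h] at this
  linarith

theorem sq_ofEdge_eq {θ : DirEdge G → ℝ} (hθ : ∀ d, θ d = -θ d.rev) (d : DirEdge G) :
    θ (DirEdge.ofEdge d.edge) ^ 2 = θ d ^ 2 := by
  rcases DirEdge.eq_or_eq_rev (DirEdge.edge_ofEdge d.edge) with h | h
  · rw [h]
  · rw [h, hθ d, neg_sq]

theorem flowEnergy_eq_sum_orientation [Finite β] (o : E(G) → DirEdge G) (ho : ∀ e, (o e).edge = e)
    (c : β → ℝ) {θ : DirEdge G → ℝ} (hθ : ∀ d, θ d = -θ d.rev) :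
    flowEnergy G c θ = ∑ e, θ (o e) ^ 2 / c e := by
  refine Finset.sum_congr rfl fun e _ => ?_
  rw [← sq_ofEdge_eq hθ (o e), ho]

open Classical in
/-- A function on the edges, read along an orientation, extends to an antisymmetric function on
the directed edges, apart from loops. -/
theorem exists_antisymm_extension (o : E(G) → DirEdge G) (ho : ∀ e, (o e).edge = e)
    (y : E(G) → ℝ) : ∃ θ : DirEdge G → ℝ, (∀ d, θ d = -θ d.rev) ∧
      ∀ e, θ (o e) = if (o e).src = (o e).tgt then 0 else y e := by
  refine ⟨fun d => (if d = o d.edge then y d.edge else 0) -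
    (if d.rev = o d.edge then y d.edge else 0), fun d => ?_, fun e => ?_⟩
  · simp only [DirEdge.rev_rev, DirEdge.edge_rev, neg_sub]
    rfl
  · simp only [ho, if_true, DirEdge.rev_eq_self_iff]
    split_ifs <;> simp

/-- A vertex of `G`, as a vertex of `G` restricted to a set of edges. -/
def toRestrict (S : Set β) (v : V(G)) : V(G.restrict S) := ⟨v.1, v.2⟩

/-- The directed edges of `G` restricted to a set of edges, as directed edges of `G`. -/
def restrictDir (S : Set β) (d : DirEdge (G.restrict S)) : DirEdge G :=
  ⟨(⟨d.src.1, d.src.2⟩, ⟨d.tgt.1, d.tgt.2⟩, ⟨d.edge.1, d.edge.2.1⟩), d.isLink.2⟩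

theorem restrictDir_injective (S : Set β) :
    Function.Injective (restrictDir (G := G) S) := by
  intro d d' h
  refine DirEdge.ext (Subtype.ext ?_) (Subtype.ext ?_) (Subtype.ext ?_)
  · exact congrArg (fun d : DirEdge G => d.src.1) h
  · exact congrArg (fun d : DirEdge G => d.tgt.1) h
  · exact congrArg (fun d : DirEdge G => d.edge.1) h

theorem mem_range_restrictDir {S : Set β} {d : DirEdge G} (h : (d.edge : β) ∈ S) :
    d ∈ Set.range (restrictDir (G := G) S) :=
  ⟨⟨(toRestrict S d.src, toRestrict S d.tgt, ⟨d.edge.1, d.edge.2, h⟩), h, d.isLink⟩, rfl⟩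

variable [Finite α] [Finite β]

open Classical in
theorem sum_mul_eq_sum_orientation (o : E(G) → DirEdge G) (ho : ∀ e, (o e).edge = e)
    {θ : DirEdge G → ℝ} (hθ : ∀ d, θ d = -θ d.rev) (u : V(G)) :
    ∑ d : DirEdge G with d.src = u, θ d =
      ∑ e, θ (o e) * ((if (o e).src = u then 1 else 0) - (if (o e).tgt = u then 1 else 0)) := by
  rw [Finset.sum_filter, DirEdge.sum_eq_sum_orientation o ho]
  · refine Finset.sum_congr rfl fun e _ => ?_
    rw [hθ (o e).rev, DirEdge.rev_rev, DirEdge.src_rev]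
    split_ifs <;> ring
  · intro d hd
    rw [eq_zero_of_rev_eq hθ d hd, ite_self]

/-- Orientation-free form of the energy: every non-loop edge is read twice, and loops carry no flow.
This is the source of the factors 2 and 1/2 on the positive side. -/
theorem two_mul_flowEnergy (c : β → ℝ) {θ : DirEdge G → ℝ} (hθ : ∀ d, θ d = -θ d.rev) :
    2 * flowEnergy G c θ = ∑ d : DirEdge G, θ d ^ 2 / c d.edge := by
  rw [DirEdge.sum_eq_sum_orientation DirEdge.ofEdge DirEdge.edge_ofEdge, flowEnergy,
    Finset.mul_sum]
  · refine Finset.sum_congr rfl fun e _ => ?_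
    rw [hθ (DirEdge.ofEdge e).rev, DirEdge.rev_rev, DirEdge.edge_rev, DirEdge.edge_ofEdge]
    ring
  · intro d hd
    rw [eq_zero_of_rev_eq hθ d hd]
    simp

open Classical in
/-- A flow has no net outflow from a set of vertices that no edge leaves. -/
theorem IsUnitFlow.reachable {s t : V(G)} {θ : DirEdge G → ℝ} (hθ : IsUnitFlow G s t θ) :
    (adjGraph G).Reachable s t := by
  by_contra hst
  -- Weight the outflows by the indicator of the component of `s`. Reversing directed edges shows
  -- that the total is its own negative, while the outflow conditions make it f(s) - f(t) = 1.
  let f : V(G) → ℝ := fun u => if (adjGraph G).Reachable s u then 1 else 0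
  have hf : ∀ d : DirEdge G, f d.src = f d.tgt := by
    intro d
    by_cases h : d.src = d.tgt
    · rw [h]
    have hadj : (adjGraph G).Adj d.src d.tgt :=
      (SimpleGraph.fromRel_adj _ _ _).2 ⟨h, Or.inl ⟨d.edge, d.isLink⟩⟩
    have : (adjGraph G).Reachable s d.src ↔ (adjGraph G).Reachable s d.tgt :=
      ⟨fun h => h.trans hadj.reachable, fun h => h.trans hadj.symm.reachable⟩
    simp only [f, this]
  have h1 : ∑ u, f u * ∑ d : DirEdge G with d.src = u, θ d = ∑ d : DirEdge G, f d.src * θ d := by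
    rw [← Finset.sum_fiberwise Finset.univ DirEdge.src]
    refine Finset.sum_congr rfl fun u _ => ?_
    rw [Finset.mul_sum]
    refine Finset.sum_congr rfl fun d hd => ?_
    rw [(Finset.mem_filter.1 hd).2]
  have h2 : ∑ d : DirEdge G, f d.src * θ d = -∑ d : DirEdge G, f d.src * θ d := by
    rw [← Finset.sum_neg_distrib, ← Equiv.sum_comp DirEdge.revEquiv]
    refine Finset.sum_congr rfl fun d _ => ?_
    change f d.rev.src * θ d.rev = _
    rw [DirEdge.src_rev, ← hf, hθ.antisymm d]
    ring
  have h3 : ∑ u, f u * ∑ d : DirEdge G with d.src = u, θ d = f s - f t := by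
    simp_rw [hθ.outflow, mul_sub, Finset.sum_sub_distrib]
    simp
  have h4 : f s = 1 := if_pos (SimpleGraph.Reachable.refl s)
  have h5 : f t = 0 := if_neg hst
  linarith

/-- Without a path there is no unit flow, so the `⊤` branch is already the infimum over the empty
set. The existence of a flow along a path is never needed. -/
theorem effRes_eq_iInf (c : β → ℝ) (s t : V(G)) :
    effRes G c s t =
      ⨅ (θ : DirEdge G → ℝ) (_ : IsUnitFlow G s t θ), ENNReal.ofReal (flowEnergy G c θ) := by
  unfold effRes
  split_ifs with h
  · rfl
  · symm
    simp only [iInf_eq_top]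
    exact fun θ hθ => absurd hθ.reachable h

theorem sum_restrictDir (S : Set β) (φ : DirEdge G → ℝ)
    (hφ : ∀ d : DirEdge G, (d.edge : β) ∉ S → φ d = 0) :
    ∑ d : DirEdge (G.restrict S), φ (restrictDir S d) = ∑ d, φ d :=
  Fintype.sum_of_injective _ (restrictDir_injective S) _ _
    (fun d hd => hφ d fun h => hd (mem_range_restrictDir h)) fun _ => rfl

/-- The arbitrary orientations `ofEdge` of the two graphs need not agree, hence the passage through
sums over all directed edges. -/
theorem flowEnergy_restrictDir (S : Set β) (c : β → ℝ) {θ : DirEdge G → ℝ}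
    (hθ : ∀ d, θ d = -θ d.rev) (hS : ∀ d : DirEdge G, (d.edge : β) ∉ S → θ d = 0) :
    flowEnergy (G.restrict S) c (θ ∘ restrictDir S) = flowEnergy G c θ := by
  have h1 := two_mul_flowEnergy c hθ
  have h2 := two_mul_flowEnergy (G := G.restrict S) c (θ := θ ∘ restrictDir S)
    fun d => hθ (restrictDir S d)
  rw [← sum_restrictDir S _ fun d hd => by simp [hS d hd]] at h1
  have h3 := h2.trans h1.symm
  linarith

open Classical in
theorem outflow_restrictDir (S : Set β) {θ : DirEdge G → ℝ}
    (hS : ∀ d : DirEdge G, (d.edge : β) ∉ S → θ d = 0) (u : V(G)) :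
    ∑ d : DirEdge (G.restrict S) with d.src = toRestrict S u, (θ ∘ restrictDir S) d =
      ∑ d : DirEdge G with d.src = u, θ d := by
  rw [Finset.sum_filter, Finset.sum_filter,
    ← sum_restrictDir S (fun d : DirEdge G => if d.src = u then θ d else 0)
      fun d hd => by simp only [hS d hd, ite_self]]
  refine Finset.sum_congr rfl fun d _ => if_congr ?_ rfl rfl
  simp only [Subtype.ext_iff]
  rfl

theorem isUnitFlow_restrictDir_iff (S : Set β) (s t : V(G)) {θ : DirEdge G → ℝ}
    (hS : ∀ d : DirEdge G, (d.edge : β) ∉ S → θ d = 0) :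
    IsUnitFlow (G.restrict S) (toRestrict S s) (toRestrict S t) (θ ∘ restrictDir S) ↔
      IsUnitFlow G s t θ := by
  classical
  have hiff (u v : V(G)) : toRestrict S u = toRestrict S v ↔ u = v := by
    simp only [Subtype.ext_iff]
    rfl
  constructor
  · intro h
    refine ⟨fun d => ?_, fun u => ?_⟩
    · by_cases hd : (d.edge : β) ∈ S
      · obtain ⟨d, rfl⟩ := mem_range_restrictDir hd
        exact h.antisymm d
      · rw [hS d hd, hS d.rev hd, neg_zero]
    · rw [← outflow_restrictDir S hS, h.outflow]
      simp only [hiff]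
  · intro h
    refine ⟨fun d => h.antisymm _, fun u => ?_⟩
    obtain ⟨u, rfl⟩ : ∃ v, toRestrict S v = u := ⟨⟨u.1, u.2⟩, rfl⟩
    rw [outflow_restrictDir S hS, h.outflow]
    simp only [hiff]

/-- Flows in a restriction of `G` are the flows in `G` that vanish off the given edges. -/
theorem effRes_restrict (S : Set β) (c : β → ℝ) (s t : V(G)) :
    effRes (G.restrict S) c (toRestrict S s) (toRestrict S t) =
      ⨅ (θ : DirEdge G → ℝ)
        (_ : IsUnitFlow G s t θ ∧ ∀ d : DirEdge G, (d.edge : β) ∉ S → θ d = 0),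
        ENNReal.ofReal (flowEnergy G c θ) := by
  rw [effRes_eq_iInf]
  apply le_antisymm
  · refine le_iInf₂ fun θ hθ => ?_
    refine (iInf₂_le (θ ∘ restrictDir S)
      ((isUnitFlow_restrictDir_iff S s t hθ.2).2 hθ.1)).trans_eq ?_
    rw [flowEnergy_restrictDir S c hθ.1.antisymm hθ.2]
  · refine le_iInf₂ fun θ hθ => ?_
    let θ' : DirEdge G → ℝ := Function.extend (restrictDir S) θ 0
    have hcomp : θ' ∘ restrictDir S = θ := funext fun d => (restrictDir_injective S).extend_apply _ _ d
    have hS : ∀ d : DirEdge G, (d.edge : β) ∉ S → θ' d = 0 := by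
      intro d hd
      refine Function.extend_apply' _ _ _ ?_
      rintro ⟨d, rfl⟩
      exact hd d.edge.2.2
    have hθ' : IsUnitFlow G s t θ' :=
      (isUnitFlow_restrictDir_iff S s t hS).1 (by rw [hcomp]; exact hθ)
    refine (iInf₂_le θ' ⟨hθ', hS⟩).trans_eq ?_
    rw [← flowEnergy_restrictDir S c hθ'.antisymm hS, hcomp]

end Networks

/-! ### Witnesses of the span program as flows and potentials -/

section GraphSpanProgram

variable {α β : Type*} {G : Graph α β}

/-- The flow of a vector `w` of `H`, normalised so that `A w` is its net outflow. -/
noncomputable def vectorFlow (c : β → ℝ) (w : EuclideanSpace ℝ (DirEdge G)) (d : DirEdge G) : ℝ :=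
  Real.sqrt (c d.edge) * (w d - w d.rev)

theorem vectorFlow_antisymm (c : β → ℝ) (w : EuclideanSpace ℝ (DirEdge G)) (d : DirEdge G) :
    vectorFlow c w d = -vectorFlow c w d.rev := by
  simp only [vectorFlow, DirEdge.edge_rev, DirEdge.rev_rev]
  ring

/-- The vector of `H` of least norm with a given flow. -/
noncomputable def flowVector (c : β → ℝ) (θ : DirEdge G → ℝ) : EuclideanSpace ℝ (DirEdge G) :=
  WithLp.toLp 2 fun d => θ d / (2 * Real.sqrt (c d.edge))

theorem vectorFlow_flowVector (c : β → ℝ) (hc : ∀ e ∈ E(G), 0 < c e) {θ : DirEdge G → ℝ}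
    (hθ : ∀ d, θ d = -θ d.rev) : vectorFlow c (flowVector c θ) = θ := by
  funext d
  have hd := (Real.sqrt_pos.2 (hc _ d.edge.2)).ne'
  simp only [vectorFlow, flowVector, DirEdge.edge_rev]
  rw [hθ d]
  field_simp
  ring

variable [Finite α] [Finite β]

open Classical in
theorem mem_edgeSpace_iff {e : E(G)} {w : EuclideanSpace ℝ (DirEdge G)} :
    w ∈ edgeSpace G e ↔ ∀ d : DirEdge G, d.edge ≠ e → w d = 0 := by
  constructor
  · intro h d hd
    induction h using Submodule.span_induction with
    | mem w hw =>
      obtain ⟨d', hd', rfl⟩ := hw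
      have : d ≠ d' := by
        rintro rfl
        exact hd hd'
      simp [this]
    | zero => rfl
    | add v w _ _ hv hw => simp [hv, hw]
    | smul a w _ hw => simp [hw]
  · intro h
    rw [← (EuclideanSpace.basisFun (DirEdge G) ℝ).sum_repr w]
    refine Submodule.sum_mem _ fun d _ => ?_
    by_cases hd : d.edge = e
    · refine Submodule.smul_mem _ _ (Submodule.subset_span ⟨d, hd, ?_⟩)
      simp
    · simp [h d hd]

/-- The vectors of `H(x)` are those supported on the directed edges `d` with `x_d = 1`. -/
theorem mem_space_iff {c : β → ℝ} {s t : V(G)} {hst : s ≠ t} {x : E(G) → Bool}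
    {w : EuclideanSpace ℝ (DirEdge G)} :
    w ∈ (stProgram G c s t hst).space x ↔ ∀ d : DirEdge G, x d.edge = false → w d = 0 := by
  classical
  constructor
  · intro h d hd
    induction h using Submodule.iSup_induction' with
    | mem e w hw =>
      change w ∈ (if x e = true then edgeSpace G e else ⊥) at hw
      split_ifs at hw with he
      · refine mem_edgeSpace_iff.1 hw d ?_
        rintro rfl
        simp [hd] at he
      · rw [(Submodule.mem_bot ℝ).1 hw]
        rfl
    | zero => rfl
    | add v w _ _ hv hw => simp [hv, hw]
  · intro h
    rw [← (EuclideanSpace.basisFun (DirEdge G) ℝ).sum_repr w]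
    refine Submodule.sum_mem _ fun d _ => ?_
    by_cases hd : x d.edge = true
    · refine Submodule.smul_mem _ _ (Submodule.mem_iSup_of_mem d.edge ?_)
      change _ ∈ (if x d.edge = true then edgeSpace G d.edge else ⊥)
      rw [if_pos hd]
      refine Submodule.subset_span ⟨d, rfl, ?_⟩
      simp
    · simp [h d (by simpa using hd)]

theorem stProgram_A_apply (c : β → ℝ) (s t : V(G)) (hst : s ≠ t)
    (w : EuclideanSpace ℝ (DirEdge G)) :
    (stProgram G c s t hst).A w = ∑ d : DirEdge G,
      w d • (Real.sqrt (c d.edge) • (Finsupp.single d.src 1 - Finsupp.single d.tgt 1)) := by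
  simp [stProgram, LinearMap.sum_apply]

-- Each `d` contributes √c·w(d) at its source and the opposite at its target; reversing the directed
-- edges in the second contribution collects everything at the source.
open Classical in
theorem stProgram_A_apply_apply (c : β → ℝ) (s t : V(G)) (hst : s ≠ t)
    (w : EuclideanSpace ℝ (DirEdge G)) (u : V(G)) :
    (stProgram G c s t hst).A w u = ∑ d : DirEdge G with d.src = u, vectorFlow c w d := by
  have h1 : ∑ d : DirEdge G, (if d.tgt = u then Real.sqrt (c d.edge) * w d else 0) =
      ∑ d : DirEdge G, (if d.src = u then Real.sqrt (c d.edge) * w d.rev else 0) := by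
    rw [← Equiv.sum_comp DirEdge.revEquiv]
    rfl
  rw [stProgram_A_apply, Finsupp.finsetSum_apply, Finset.sum_filter]
  simp only [vectorFlow, mul_sub, Finset.sum_sub_distrib, Finsupp.smul_apply, Finsupp.sub_apply,
    Finsupp.single_apply, smul_eq_mul]
  rw [← sub_eq_zero]
  have h2 (p q : ℝ) (P : Prop) [Decidable P] :
      (if P then p - q else 0) = (if P then p else 0) - (if P then q else 0) := by
    split_ifs <;> simp
  simp only [h2, Finset.sum_sub_distrib]
  rw [← h1]
  simp only [← Finset.sum_sub_distrib]
  refine Finset.sum_eq_zero fun d _ => ?_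
  split_ifs <;> ring

theorem A_eq_target_iff (c : β → ℝ) (s t : V(G)) (hst : s ≠ t)
    (w : EuclideanSpace ℝ (DirEdge G)) :
    (stProgram G c s t hst).A w = (stProgram G c s t hst).target ↔
      IsUnitFlow G s t (vectorFlow c w) := by
  classical
  rw [Finsupp.ext_iff]
  constructor
  · intro h
    refine ⟨vectorFlow_antisymm c w, fun u => ?_⟩
    rw [← stProgram_A_apply_apply c s t hst, h]
    simp [stProgram, Finsupp.single_apply, eq_comm]
  · intro h u
    rw [stProgram_A_apply_apply, h.outflow]
    simp [stProgram, Finsupp.single_apply, eq_comm]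

/-- The weight cancels, and (a - b)² ≤ 2(a² + b²) with equality for b = -a, which is why an
antisymmetric vector is optimal. -/
theorem flowEnergy_vectorFlow_le (c : β → ℝ) (hc : ∀ e ∈ E(G), 0 < c e)
    (w : EuclideanSpace ℝ (DirEdge G)) :
    flowEnergy G c (vectorFlow c w) ≤ 2 * ‖w‖ ^ 2 := by
  have h := two_mul_flowEnergy c (vectorFlow_antisymm c w)
  have h1 : ∀ d : DirEdge G, vectorFlow c w d ^ 2 / c d.edge ≤ 2 * (w d ^ 2 + w d.rev ^ 2) := by
    intro d
    have hd := hc _ d.edge.2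
    rw [vectorFlow, mul_pow, Real.sq_sqrt hd.le, mul_div_assoc, mul_div_cancel₀ _ hd.ne']
    nlinarith [sq_nonneg (w d + w d.rev)]
  have h2 : ∑ d : DirEdge G, w d.rev ^ 2 = ∑ d : DirEdge G, w d ^ 2 :=
    Equiv.sum_comp DirEdge.revEquiv fun d => w d ^ 2
  have h3 := Finset.sum_le_sum fun d (_ : d ∈ Finset.univ) => h1 d
  rw [← h, ← Finset.mul_sum, Finset.sum_add_distrib, h2] at h3
  rw [EuclideanSpace.real_norm_sq_eq]
  linarith

theorem two_mul_norm_sq_flowVector (c : β → ℝ) (hc : ∀ e ∈ E(G), 0 < c e) {θ : DirEdge G → ℝ}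
    (hθ : ∀ d, θ d = -θ d.rev) : 2 * ‖flowVector c θ‖ ^ 2 = flowEnergy G c θ := by
  have h := two_mul_flowEnergy c hθ
  have h1 : 4 * ‖flowVector c θ‖ ^ 2 = ∑ d : DirEdge G, θ d ^ 2 / c d.edge := by
    rw [EuclideanSpace.real_norm_sq_eq, Finset.mul_sum]
    refine Finset.sum_congr rfl fun d _ => ?_
    have hd := hc _ d.edge.2
    simp only [flowVector]
    rw [div_pow, mul_pow, Real.sq_sqrt hd.le]
    field_simp
    ring
  linarith

/-- The positive witness size is half the effective resistance. -/
theorem posSize_stProgram (c : β → ℝ) (hc : ∀ e ∈ E(G), 0 < c e) (s t : V(G)) (hst : s ≠ t)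
    (x : E(G) → Bool) :
    (stProgram G c s t hst).posSize x =
      1 / 2 * effRes (inputGraph G x) c ⟨s.1, s.2⟩ ⟨t.1, t.2⟩ := by
  have hS (d : DirEdge G) : (d.edge : β) ∉ {e | ∃ h : e ∈ E(G), x ⟨e, h⟩ = true} ↔
      x d.edge = false := by
    simp
  have hhalf : (1 / 2 : ℝ≥0∞) = ENNReal.ofReal (1 / 2) := by
    rw [ENNReal.ofReal_div_of_pos two_pos]
    simp
  refine Eq.trans ?_ (congrArg (1 / 2 * ·) (effRes_restrict _ c s t).symm)
  simp only [hS]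
  rw [hhalf, ENNReal.mul_iInf_of_ne (by simp) (by simp)]
  unfold SpanProgram.posSize
  apply le_antisymm
  · refine le_iInf fun θ => ?_
    rw [ENNReal.mul_iInf_of_ne (by simp) (by simp)]
    refine le_iInf fun hθ => ?_
    refine (iInf₂_le (flowVector c θ) ⟨mem_space_iff.2 fun d hd => by
      simp [flowVector, hθ.2 d hd],
      (A_eq_target_iff c s t hst _).2 (by
        rw [vectorFlow_flowVector c hc hθ.1.antisymm]
        exact hθ.1)⟩).trans ?_
    · rw [← ENNReal.ofReal_mul (by norm_num), ← two_mul_norm_sq_flowVector c hc hθ.1.antisymm]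
      exact ENNReal.ofReal_le_ofReal (by linarith)
  · refine le_iInf₂ fun w hw => ?_
    have h := mem_space_iff.1 hw.1
    refine (iInf_le _ (vectorFlow c w)).trans ?_
    rw [ENNReal.mul_iInf_of_ne (by simp) (by simp)]
    refine (iInf_le _ ⟨(A_eq_target_iff c s t hst w).1 hw.2, fun d hd => by
      rw [vectorFlow, h d hd, h d.rev hd, sub_zero, mul_zero]⟩).trans ?_
    · rw [← ENNReal.ofReal_mul (by norm_num)]
      exact ENNReal.ofReal_le_ofReal (by linarith [flowEnergy_vectorFlow_le c hc w])

/-- The squared norm `‖ω A‖²` for the functional `ω` with values `f`. -/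
noncomputable def potentialEnergy (G : Graph α β) (c : β → ℝ) (f : V(G) → ℝ) : ℝ :=
  ∑ d : DirEdge G, c d.edge * (f d.src - f d.tgt) ^ 2

theorem comp_A_apply (c : β → ℝ) (s t : V(G)) (hst : s ≠ t) (ω : (V(G) →₀ ℝ) →ₗ[ℝ] ℝ)
    (w : EuclideanSpace ℝ (DirEdge G)) :
    (ω ∘ₗ (stProgram G c s t hst).A) w = ∑ d : DirEdge G, w d *
      (Real.sqrt (c d.edge) * (ω (Finsupp.single d.src 1) - ω (Finsupp.single d.tgt 1))) := by
  rw [LinearMap.comp_apply, stProgram_A_apply, map_sum]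
  simp

theorem norm_sq_comp_A (c : β → ℝ) (hc : ∀ e ∈ E(G), 0 < c e) (s t : V(G)) (hst : s ≠ t)
    (ω : (V(G) →₀ ℝ) →ₗ[ℝ] ℝ) :
    ‖LinearMap.toContinuousLinearMap (ω ∘ₗ (stProgram G c s t hst).A)‖ ^ 2 =
      potentialEnergy G c fun u => ω (Finsupp.single u 1) := by
  -- The Riesz vector of `ω A`, which turns the operator norm into a sum of squares.
  let k : EuclideanSpace ℝ (DirEdge G) := WithLp.toLp 2 fun d =>
    Real.sqrt (c d.edge) * (ω (Finsupp.single d.src 1) - ω (Finsupp.single d.tgt 1))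
  have hk : LinearMap.toContinuousLinearMap (ω ∘ₗ (stProgram G c s t hst).A) =
      InnerProductSpace.toDual ℝ _ k := by
    ext w
    rw [LinearMap.coe_toContinuousLinearMap', comp_A_apply, InnerProductSpace.toDual_apply_apply,
      PiLp.inner_apply]
    rfl
  rw [hk, LinearIsometryEquiv.norm_map, EuclideanSpace.real_norm_sq_eq]
  refine Finset.sum_congr rfl fun d _ => ?_
  simp only [k]
  rw [mul_pow, Real.sq_sqrt (hc _ d.edge.2).le]

theorem isNegWitness_iff (c : β → ℝ) (hc : ∀ e ∈ E(G), 0 < c e) (s t : V(G)) (hst : s ≠ t)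
    (x : E(G) → Bool) (ω : (V(G) →₀ ℝ) →ₗ[ℝ] ℝ) :
    (stProgram G c s t hst).IsNegWitness x ω ↔
      ω (Finsupp.single s 1) - ω (Finsupp.single t 1) = 1 ∧ ∀ d : DirEdge G, x d.edge = true →
        ω (Finsupp.single d.src 1) = ω (Finsupp.single d.tgt 1) := by
  classical
  rw [and_comm, ← map_sub]
  refine and_congr ⟨fun h d hd => ?_, fun h => ?_⟩ Iff.rfl
  -- Basis vectors of available edges are fixed by the projector; evaluating on one gives √c times
  -- the potential difference, and √c is nonzero.
  · have hmem : EuclideanSpace.single d (1 : ℝ) ∈ (stProgram G c s t hst).space x := by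
      refine mem_space_iff.2 fun d' hd' => ?_
      have : d' ≠ d := by
        rintro rfl
        simp [hd] at hd'
      simp [this]
    have h1 := LinearMap.congr_fun h (EuclideanSpace.single d (1 : ℝ))
    rw [← LinearMap.comp_assoc, LinearMap.comp_apply, ContinuousLinearMap.coe_coe,
      Submodule.starProjection_eq_self_iff.2 hmem, comp_A_apply] at h1
    simp only [PiLp.single_apply, ite_mul, one_mul, zero_mul] at h1
    rw [Finset.sum_ite_eq' Finset.univ d, if_pos (Finset.mem_univ d), LinearMap.zero_apply] at h1
    have hd := (Real.sqrt_pos.2 (hc _ d.edge.2)).ne'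
    exact sub_eq_zero.1 ((mul_eq_zero.1 h1).resolve_left hd)
  · ext1 w
    have hw : (stProgram G c s t hst |>.space x).starProjection w ∈
      (stProgram G c s t hst).space x := Submodule.starProjection_apply_mem _ _
    rw [← LinearMap.comp_assoc, LinearMap.comp_apply, ContinuousLinearMap.coe_coe, comp_A_apply,
      LinearMap.zero_apply]
    refine Finset.sum_eq_zero fun d _ => ?_
    cases hd : x d.edge
    · rw [mem_space_iff.1 hw d hd, zero_mul]
    · rw [h d hd, sub_self, mul_zero, mul_zero]

/-- The negative witness size is the least energy of a potential. -/
theorem negSize_stProgram (c : β → ℝ) (hc : ∀ e ∈ E(G), 0 < c e) (s t : V(G)) (hst : s ≠ t)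
    (x : E(G) → Bool) :
    (stProgram G c s t hst).negSize x =
      ⨅ (f : V(G) → ℝ)
        (_ : f s - f t = 1 ∧ ∀ d : DirEdge G, x d.edge = true → f d.src = f d.tgt),
        ENNReal.ofReal (potentialEnergy G c f) := by
  unfold SpanProgram.negSize
  simp only [isNegWitness_iff c hc, norm_sq_comp_A c hc]
  apply le_antisymm
  · refine le_iInf₂ fun f hf => ?_
    have h (u : V(G)) : Finsupp.linearCombination ℝ f (Finsupp.single u 1) = f u := by simp
    refine (iInf₂_le (Finsupp.linearCombination ℝ f) ?_).trans_eq ?_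
    · simpa only [h] using hf
    · simp only [h]
  · exact le_iInf₂ fun ω hω => iInf₂_le (fun u => ω (Finsupp.single u 1)) hω

end GraphSpanProgram

/-! ### Vertex and face differences on the sphere -/

section Planar

variable {α β F : Type*}

namespace PlaneEmbedding

variable {K : Graph α β} (M : PlaneEmbedding K F)

/-- The differences of a function on the vertices along the edges. -/
def vertexDiff : (V(K) → ℝ) →ₗ[ℝ] (E(K) → ℝ) where
  toFun f e := f (M.tail (e, false)) - f (M.tail (e, true))
  map_add' f g := by
    funext e
    simp only [Pi.add_apply]
    ring
  map_smul' a f := by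
    funext e
    simp only [Pi.smul_apply, smul_eq_mul, RingHom.id_apply]
    ring

/-- The differences of a function on the faces across the edges. -/
def faceDiff : (F → ℝ) →ₗ[ℝ] (E(K) → ℝ) where
  toFun h e := h (M.left (e, false)) - h (M.left (e, true))
  map_add' f g := by
    funext e
    simp only [Pi.add_apply]
    ring
  map_smul' a f := by
    funext e
    simp only [Pi.smul_apply, smul_eq_mul, RingHom.id_apply]
    ring

theorem vertexDiff_apply (f : V(K) → ℝ) (e : E(K)) :
    M.vertexDiff f e = f (M.tail (e, false)) - f (M.tail (e, true)) := rfl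

theorem faceDiff_apply (h : F → ℝ) (e : E(K)) :
    M.faceDiff h e = h (M.left (e, false)) - h (M.left (e, true)) := rfl

theorem tail_rot (a : HalfEdge K) : M.tail (M.rot a) = M.tail a :=
  (M.sameCycle_rot _ _).1 (Equiv.Perm.sameCycle_apply_left.2 (Equiv.Perm.SameCycle.refl _ _))

def flipEquiv : Equiv.Perm (HalfEdge K) :=
  ⟨HalfEdge.flip, HalfEdge.flip, fun a => by simp [HalfEdge.flip],
    fun a => by simp [HalfEdge.flip]⟩

/-- The differences of a function on the vertices sum to zero around each face. -/
theorem sum_vertexDiff_mul_faceDiff [Finite β] (f : V(K) → ℝ) (h : F → ℝ) :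
    ∑ e, M.vertexDiff f e * M.faceDiff h e = 0 := by
  -- Face tracing a ↦ `rot a.flip` permutes the half-edges, keeps the left face and moves the tail
  -- to the other end. The difference of the two sums, grouped by edges, is the pairing.
  have h1 : ∑ a : HalfEdge K, h (M.left a) * f (M.tail a) =
      ∑ a : HalfEdge K, h (M.left a) * f (M.tail a.flip) := by
    rw [← Equiv.sum_comp (flipEquiv.trans M.rot)]
    refine Finset.sum_congr rfl fun a _ => ?_
    change h (M.left (M.rot a.flip)) * f (M.tail (M.rot a.flip)) = _
    rw [M.left_rot_flip, M.tail_rot]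
  rw [← sub_eq_zero, ← Finset.sum_sub_distrib, Fintype.sum_prod_type] at h1
  rw [← h1]
  refine Finset.sum_congr rfl fun e _ => ?_
  rw [Fintype.sum_bool]
  simp only [HalfEdge.flip, vertexDiff_apply, faceDiff_apply, Bool.not_true, Bool.not_false]
  ring

theorem eq_of_reachable_of_vertexDiff_eq_zero {f : V(K) → ℝ} (hf : M.vertexDiff f = 0)
    {u v : V(K)} (huv : (adjGraph K).Reachable u v) : f u = f v := by
  have hlink : ∀ {u v : V(K)}, K.Adj u v → f u = f v := by
    rintro u v ⟨e, he⟩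
    have h1 := sub_eq_zero.1 (congrFun hf ⟨e, he.edge_mem⟩)
    rcases he.eq_and_eq_or_eq_and_eq (M.isLink_tail (⟨e, he.edge_mem⟩, false)) with
      ⟨hu, hv⟩ | ⟨hu, hv⟩
    · exact (congrArg f (Subtype.ext hu)).trans (h1.trans (congrArg f (Subtype.ext hv)).symm)
    · exact (congrArg f (Subtype.ext hu)).trans (h1.symm.trans (congrArg f (Subtype.ext hv)).symm)
  obtain ⟨p⟩ := huv
  induction p with
  | nil => rfl
  | cons hadj _ ih =>
    refine Eq.trans ?_ ih
    rcases ((SimpleGraph.fromRel_adj _ _ _).1 hadj).2 with h | h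
    · exact hlink h
    · exact (hlink h).symm

/-- A function on the faces that is constant across edges is constant: the dual is connected. -/
theorem eq_of_faceDiff_eq_zero {h : F → ℝ} (hh : M.faceDiff h = 0) (φ ψ : F) : h φ = h ψ := by
  have hflip (a : HalfEdge K) : h (M.left a.flip) = h (M.left a) := by
    have := sub_eq_zero.1 (congrFun hh a.1)
    obtain ⟨e, b⟩ := a
    cases b
    · exact this.symm
    · exact this
  have hrot (a : HalfEdge K) : h (M.left (M.rot a)) = h (M.left a) := by
    have := M.left_rot_flip a.flip
    rw [show a.flip.flip = a from flipEquiv.left_inv a] at this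
    rw [this, hflip]
  have hrot' (a b : HalfEdge K) (hab : M.tail a = M.tail b) : h (M.left a) = h (M.left b) := by
    obtain ⟨n, hn⟩ := (M.sameCycle_rot a b).2 hab
    rw [← hn]
    clear hn hab
    induction n using Int.induction_on with
    | zero => rfl
    | succ n ih => rw [add_comm, zpow_add, zpow_one, Equiv.Perm.mul_apply, hrot, ih]
    | pred n ih =>
      rw [ih, ← hrot ((M.rot ^ (-(n : ℤ) - 1)) a), ← Equiv.Perm.mul_apply, ← zpow_one_add]
      congr 4
      ring
  -- All faces touching a vertex have the same value of `h`, so `h` extends to the vertices, with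
  -- isolated ones taking the value of their face. Connectedness of the vertex–face incidence then
  -- finishes.
  have hvert : ∃ k : V(K) → ℝ, (∀ a, k (M.tail a) = h (M.left a)) ∧
      ∀ v, k v.1 = h (M.isolatedFace v) := by
    classical
    refine ⟨fun v => if hv : ∃ a, M.tail a = v then h (M.left hv.choose) else
      h (M.isolatedFace ⟨v, not_exists.1 hv⟩), fun a => ?_, fun v => ?_⟩
    · have ha : ∃ b, M.tail b = M.tail a := ⟨a, rfl⟩
      exact (dif_pos ha).trans (hrot' _ _ ha.choose_spec)
    · exact dif_neg (not_exists.2 v.2)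
  obtain ⟨k, hk, hk'⟩ := hvert
  have htouch : ∀ p q : V(K) ⊕ F, (∃ v f, p = .inl v ∧ q = .inr f ∧
      ((∃ a, M.tail a = v ∧ M.left a = f) ∨ ∃ h, M.isolatedFace ⟨v, h⟩ = f)) →
      Sum.elim k h p = Sum.elim k h q := by
    rintro _ _ ⟨v, f, rfl, rfl, ⟨a, rfl, rfl⟩ | ⟨hv, rfl⟩⟩
    · exact hk a
    · exact hk' ⟨v, hv⟩
  have key : ∀ p q : V(K) ⊕ F, Sum.elim k h p = Sum.elim k h q := by
    intro p q
    obtain ⟨w⟩ := M.connected.preconnected p q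
    induction w with
    | nil => rfl
    | cons hadj _ ih =>
      refine Eq.trans ?_ ih
      rcases ((SimpleGraph.fromRel_adj _ _ _).1 hadj).2 with h | h
      · exact htouch _ _ h
      · exact (htouch _ _ h).symm
  exact key (.inr φ) (.inr ψ)

/-- Functions in the kernel factor through the components. Upper bounds on kernels suffice, since
only lower bounds on the ranks enter the count with Euler's formula. -/
theorem finrank_ker_vertexDiff_le [Finite α] :
    Module.finrank ℝ (LinearMap.ker M.vertexDiff) ≤
      Nat.card (adjGraph K).ConnectedComponent := by
  have : Fintype (adjGraph K).ConnectedComponent := Fintype.ofFinite _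
  let L : ((adjGraph K).ConnectedComponent → ℝ) →ₗ[ℝ] (V(K) → ℝ) :=
    LinearMap.funLeft ℝ ℝ (adjGraph K).connectedComponentMk
  have hle : LinearMap.ker M.vertexDiff ≤ LinearMap.range L := by
    intro f hf
    refine ⟨fun C => C.lift f fun v w p _ =>
      M.eq_of_reachable_of_vertexDiff_eq_zero hf p.reachable, ?_⟩
    rfl
  refine (Submodule.finrank_mono hle).trans ((LinearMap.finrank_range_le L).trans_eq ?_)
  rw [Module.finrank_pi, Nat.card_eq_fintype_card]

theorem finrank_ker_faceDiff_le : Module.finrank ℝ (LinearMap.ker M.faceDiff) ≤ 1 := by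
  let L : (Unit → ℝ) →ₗ[ℝ] (F → ℝ) := LinearMap.funLeft ℝ ℝ fun _ => ()
  have hle : LinearMap.ker M.faceDiff ≤ LinearMap.range L := by
    intro h hh
    rcases isEmpty_or_nonempty F with hF | ⟨⟨φ⟩⟩
    · exact ⟨0, funext fun φ => hF.elim φ⟩
    · exact ⟨fun _ => h φ, funext fun ψ => M.eq_of_faceDiff_eq_zero hh φ ψ⟩
  refine (Submodule.finrank_mono hle).trans ((LinearMap.finrank_range_le L).trans_eq ?_)
  simp

/-- On a sphere, a function on the edges that sums to zero around each face is the difference of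
a function on the vertices. -/
theorem exists_vertexDiff_eq [Finite α] [Finite β] [Finite F] [DecidableEq F] (y : E(K) → ℝ)
    (hy : ∀ φ, ∑ e, y e * M.faceDiff (fun ψ => if ψ = φ then 1 else 0) e = 0) :
    ∃ f, M.vertexDiff f = y := by
  have : Fintype F := Fintype.ofFinite _
  have hy' (h : F → ℝ) : ∑ e, y e * M.faceDiff h e = 0 := by
    have hsum : h = ∑ φ, h φ • fun ψ => if ψ = φ then (1 : ℝ) else 0 := by
      funext ψ
      simp
    rw [hsum, map_sum]
    simp only [map_smul, Finset.sum_apply, Pi.smul_apply, smul_eq_mul, Finset.mul_sum]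
    rw [Finset.sum_comm]
    refine Finset.sum_eq_zero fun φ _ => ?_
    have := congrArg (h φ * ·) (hy φ)
    simp only [Finset.mul_sum, mul_zero] at this
    refine Eq.trans (Finset.sum_congr rfl fun e _ => ?_) this
    ring
  have hself (v : E(K) → ℝ) (hv : ∑ e, v e * v e = 0) : v = 0 := by
    funext e
    exact mul_self_eq_zero.1
      ((Finset.sum_eq_zero_iff_of_nonneg fun e _ => mul_self_nonneg (v e)).1 hv e
        (Finset.mem_univ e))
  have hdisj : Disjoint (LinearMap.range M.vertexDiff) (LinearMap.range M.faceDiff) := by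
    rw [Submodule.disjoint_def]
    rintro v ⟨f, rfl⟩ ⟨h, hh⟩
    refine hself _ ?_
    have := M.sum_vertexDiff_mul_faceDiff f h
    rwa [hh] at this
  -- The ranks are at least V - C and F - 1, and these add up to E by Euler's formula.
  have hrank : Module.finrank ℝ (E(K) → ℝ) ≤ Module.finrank ℝ (LinearMap.range M.vertexDiff) +
      Module.finrank ℝ (LinearMap.range M.faceDiff) := by
    have h1 := LinearMap.finrank_range_add_finrank_ker M.vertexDiff
    have h2 := LinearMap.finrank_range_add_finrank_ker M.faceDiff
    have h3 := M.finrank_ker_vertexDiff_le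
    have h4 := M.finrank_ker_faceDiff_le
    have h5 := M.euler
    rw [Module.finrank_pi, ← Nat.card_eq_fintype_card] at h1 h2
    rw [Module.finrank_pi, ← Nat.card_eq_fintype_card]
    omega
  have htop := Submodule.eq_top_of_disjoint _ _ hrank hdisj
  obtain ⟨_, ⟨f, rfl⟩, _, ⟨h, rfl⟩, hfh⟩ :=
    Submodule.mem_sup.1 (htop ▸ Submodule.mem_top : y ∈ _)
  refine ⟨f, ?_⟩
  -- The face part of `y` is orthogonal to `y` and to the vertex part, hence to itself.
  have hzero : M.faceDiff h = 0 := by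
    refine hself _ ?_
    have h1 := hy' h
    have h2 := M.sum_vertexDiff_mul_faceDiff f h
    rw [← hfh] at h1
    simp only [Pi.add_apply, add_mul, Finset.sum_add_distrib] at h1
    linarith
  rw [← hfh, hzero, add_zero]

end PlaneEmbedding

end Planar

/-! ### Potentials on the graph and flows in the dual -/

section Duality

variable {α β F : Type*} {G : Graph α β} {s t : V(G)}

/-- An edge of `G` as an edge of `G` with an added `st`-edge. -/
def someEdge (e : E(G)) : E(addEdge G s t) :=
  ⟨some e.1, let ⟨u, v, h⟩ := Graph.exists_isLink_of_mem_edgeSet e.2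
    Graph.IsLink.edge_mem (G := addEdge G s t) (x := u) (y := v) h⟩

/-- The added `st`-edge. -/
def noneEdge : E(addEdge G s t) :=
  ⟨none, Graph.IsLink.edge_mem (G := addEdge G s t) (x := s.1) (y := t.1) rfl⟩

theorem mem_edgeSet_of_some_mem {e : β} (h : some e ∈ E(addEdge G s t)) : e ∈ E(G) := by
  obtain ⟨u, v, huv⟩ := Graph.exists_isLink_of_mem_edgeSet h
  exact Graph.IsLink.edge_mem (G := G) huv

def addEdgeEquiv : Option E(G) ≃ E(addEdge G s t) where
  toFun o := o.elim noneEdge someEdge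
  invFun
    | ⟨none, _⟩ => none
    | ⟨some e, h⟩ => some ⟨e, mem_edgeSet_of_some_mem h⟩
  left_inv o := by cases o <;> rfl
  right_inv := by rintro ⟨_ | e, h⟩ <;> rfl

theorem sum_addEdge [Finite β] (k : E(addEdge G s t) → ℝ) :
    ∑ e, k e = k noneEdge + ∑ e : E(G), k (someEdge e) := by
  rw [← Equiv.sum_comp addEdgeEquiv, Fintype.sum_option]
  rfl

variable (M : PlaneEmbedding (addEdge G s t) F)

/-- The orientation of the edges of `G` given by the half-edges of an embedding. -/
def primalDir (e : E(G)) : DirEdge G :=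
  ⟨(M.tail (someEdge e, false), M.tail (someEdge e, true), e), M.isLink_tail (someEdge e, false)⟩

theorem isLink_dualGraph (e : E(G)) : (dualGraph M).IsLink e.1 (M.left (someEdge e, false))
    (M.left (someEdge e, true)) :=
  ⟨(someEdge e).2, rfl⟩

/-- The edges of the dual graph are the edges of `G`. -/
def dualEdgeEquiv : E(dualGraph M) ≃ E(G) where
  toFun e := ⟨e.1, let ⟨_, _, h, _⟩ := Graph.exists_isLink_of_mem_edgeSet e.2
    mem_edgeSet_of_some_mem h⟩
  invFun e := ⟨e.1, (isLink_dualGraph M e).edge_mem⟩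
  left_inv _ := rfl
  right_inv _ := rfl

/-- The dual edge of `e`, directed from the left of `e` to its right. -/
def dualDir (e : E(dualGraph M)) : DirEdge (dualGraph M) :=
  ⟨(⟨M.left (someEdge (dualEdgeEquiv M e), false), Set.mem_univ _⟩,
    ⟨M.left (someEdge (dualEdgeEquiv M e), true), Set.mem_univ _⟩, e),
    isLink_dualGraph M (dualEdgeEquiv M e)⟩

/-- The differences of a function on the vertices of `G` along the edges and the added edge. -/
def primalDiff (f : V(G) → ℝ) : E(addEdge G s t) → ℝ :=
  M.vertexDiff fun v => f ⟨v.1, v.2⟩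

theorem primalDiff_someEdge (f : V(G) → ℝ) (e : E(G)) :
    primalDiff M f (someEdge e) = f (primalDir M e).src - f (primalDir M e).tgt := rfl

/-- The embedding does not prescribe which half of the added edge sits at `s`; the sign σ records
it. -/
theorem primalDiff_noneEdge : ∃ σ : ℝ, σ * σ = 1 ∧
    ∀ f : V(G) → ℝ, primalDiff M f noneEdge = σ * (f s - f t) := by
  have h : s((M.tail (noneEdge, false)).1, (M.tail (noneEdge, true)).1) = s(s.1, t.1) :=
    M.isLink_tail (noneEdge, false)
  rcases Sym2.eq_iff.1 h with ⟨h1, h2⟩ | ⟨h1, h2⟩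
  · refine ⟨1, by norm_num, fun f => ?_⟩
    rw [one_mul]
    exact congrArg₂ (f · - f ·) (Subtype.ext h1) (Subtype.ext h2)
  · refine ⟨-1, by norm_num, fun f => ?_⟩
    rw [neg_one_mul, neg_sub]
    exact congrArg₂ (f · - f ·) (Subtype.ext h1) (Subtype.ext h2)

theorem faceDiff_noneEdge {s' t' : F} (h : M.dual.IsLink none s' t') : ∃ σ : ℝ, σ * σ = 1 ∧
    ∀ k : F → ℝ, M.faceDiff k noneEdge = σ * (k s' - k t') := by
  obtain ⟨_, h⟩ := h
  rcases Sym2.eq_iff.1 h with ⟨h1, h2⟩ | ⟨h1, h2⟩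
  · refine ⟨1, by norm_num, fun f => ?_⟩
    rw [M.faceDiff_apply, h1, h2, one_mul]
    rfl
  · refine ⟨-1, by norm_num, fun f => ?_⟩
    rw [M.faceDiff_apply, h1, h2, neg_one_mul, neg_sub]
    rfl

theorem primalDiff_someEdge_eq_zero_iff (x : E(G) → Bool) (f : V(G) → ℝ) :
    (∀ d : DirEdge G, x d.edge = true → f d.src = f d.tgt) ↔
      ∀ e, x e = true → primalDiff M f (someEdge e) = 0 := by
  constructor
  · intro h e he
    exact sub_eq_zero.2 (h (primalDir M e) he)
  · intro h d hd
    have h1 : f (primalDir M d.edge).src = f (primalDir M d.edge).tgt :=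
      sub_eq_zero.1 (h d.edge hd)
    rcases DirEdge.eq_or_eq_rev (show d.edge = (primalDir M d.edge).edge from rfl) with h2 | h2
    · rw [h2]
      exact h1
    · rw [h2]
      exact h1.symm

theorem flowEnergy_dualGraph [Finite β] (c : β → ℝ) {θ : DirEdge (dualGraph M) → ℝ}
    (hθ : ∀ d, θ d = -θ d.rev) : flowEnergy (dualGraph M) (fun e => 1 / c e) θ =
      ∑ e : E(G), c e * θ (dualDir M ((dualEdgeEquiv M).symm e)) ^ 2 := by
  rw [flowEnergy_eq_sum_orientation (dualDir M) (fun _ => rfl) _ hθ,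
    ← Equiv.sum_comp (dualEdgeEquiv M).symm]
  refine Finset.sum_congr rfl fun e _ => ?_
  rw [div_div_eq_mul_div, div_one, mul_comm]
  rfl

theorem potentialEnergy_eq [Finite α] [Finite β] (c : β → ℝ) (f : V(G) → ℝ) :
    potentialEnergy G c f = 2 * ∑ e : E(G), c e * primalDiff M f (someEdge e) ^ 2 := by
  unfold potentialEnergy
  rw [DirEdge.sum_eq_sum_orientation (primalDir M) (fun _ => rfl), Finset.mul_sum]
  · refine Finset.sum_congr rfl fun e _ => ?_
    have he : (primalDir M e).edge = e := rfl
    rw [primalDiff_someEdge, DirEdge.src_rev, DirEdge.tgt_rev, DirEdge.edge_rev, he]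
    ring
  · intro d hd
    rw [DirEdge.rev_eq_self_iff.1 hd]
    ring

-- Net outflow at a face is the pairing with the face difference of its indicator, so conservation
-- in the dual becomes an orthogonality relation.
open Classical in
theorem outflow_dualGraph [Finite β] [Finite F] {θ : DirEdge (dualGraph M) → ℝ} (hθ : ∀ d, θ d = -θ d.rev)
    (φ : V(dualGraph M)) : ∑ d : DirEdge (dualGraph M) with d.src = φ, θ d =
      ∑ e : E(G), θ (dualDir M ((dualEdgeEquiv M).symm e)) *
        M.faceDiff (fun ψ => if ψ = φ.1 then 1 else 0) (someEdge e) := by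
  rw [sum_mul_eq_sum_orientation (dualDir M) (fun _ => rfl) hθ,
    ← Equiv.sum_comp (dualEdgeEquiv M).symm]
  refine Finset.sum_congr rfl fun e _ => ?_
  simp only [Subtype.ext_iff]
  rfl

variable [Finite α] [Finite β] [Finite F]

/-- A potential on `G` induces a flow in the dual. -/
theorem exists_flow_of_potential {s' t' : F} (hst' : M.dual.IsLink none s' t') (c : β → ℝ)
    (hc : ∀ e ∈ E(G), 0 < c e) (x : E(G) → Bool) (f : V(G) → ℝ) (hf : f s - f t = 1)
    (hx : ∀ d : DirEdge G, x d.edge = true → f d.src = f d.tgt) :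
    ∃ θ : DirEdge (dualGraph M) → ℝ,
      IsUnitFlow (dualGraph M) ⟨s', Set.mem_univ s'⟩ ⟨t', Set.mem_univ t'⟩ θ ∧
      (∀ d, x (dualEdgeEquiv M d.edge) = true → θ d = 0) ∧
      2 * flowEnergy (dualGraph M) (fun e => 1 / c e) θ ≤ potentialEnergy G c f := by
  classical
  rw [primalDiff_someEdge_eq_zero_iff M] at hx
  obtain ⟨σ, hσ, hvert⟩ := primalDiff_noneEdge M
  obtain ⟨τ, hτ, hface⟩ := faceDiff_noneEdge M hst'
  -- Orthogonality leaves the outflow -στ([φ = s'] - [φ = t']) on the edges of `G`; the factor -στ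
  -- corrects the sign.
  obtain ⟨θ, hθ, hθo⟩ := exists_antisymm_extension (dualDir M) (fun _ => rfl)
    fun e => -(σ * τ) * primalDiff M f (someEdge (dualEdgeEquiv M e))
  refine ⟨θ, ⟨hθ, fun φ => ?_⟩, fun d hd => ?_, ?_⟩
  · have h1 : ∑ e, primalDiff M f e * M.faceDiff (fun ψ => if ψ = φ.1 then 1 else 0) e = 0 :=
      M.sum_vertexDiff_mul_faceDiff _ _
    rw [sum_addEdge, hvert, hface, hf] at h1
    have h2 : ∑ d : DirEdge (dualGraph M) with d.src = φ, θ d = ∑ e : E(G), -(σ * τ) *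
        (primalDiff M f (someEdge e) *
          M.faceDiff (fun ψ => if ψ = φ.1 then 1 else 0) (someEdge e)) := by
      rw [outflow_dualGraph M hθ]
      refine Finset.sum_congr rfl fun e _ => ?_
      rw [hθo]
      split_ifs with hloop
      · have : M.left (someEdge e, false) = M.left (someEdge e, true) :=
          congrArg Subtype.val hloop
        rw [M.faceDiff_apply, this]
        ring
      · rw [Equiv.apply_symm_apply, mul_assoc]
    rw [h2, ← Finset.mul_sum, ← neg_eq_iff_add_eq_zero.2 h1]
    simp only [Subtype.ext_iff, eq_comm (a := φ.1)]
    linear_combination (τ * τ * ((if s' = φ.1 then 1 else 0) - (if t' = φ.1 then 1 else 0))) * hσ +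
      ((if s' = φ.1 then 1 else 0) - (if t' = φ.1 then 1 else 0)) * hτ
  · have h1 : θ (dualDir M d.edge) = 0 := by
      rw [hθo, hx _ hd, mul_zero, ite_self]
    rcases DirEdge.eq_or_eq_rev (show d.edge = (dualDir M d.edge).edge from rfl) with h2 | h2
    · rw [h2, h1]
    · rw [h2, hθ, DirEdge.rev_rev, h1, neg_zero]
  · rw [flowEnergy_dualGraph M c hθ, potentialEnergy_eq M]
    refine mul_le_mul_of_nonneg_left (Finset.sum_le_sum fun e _ => ?_) zero_le_two
    refine mul_le_mul_of_nonneg_left ?_ (hc _ e.2).le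
    rw [hθo, Equiv.apply_symm_apply]
    -- A dual loop carries no flow although the potential may differ across its primal edge; this is
    -- why only an inequality holds.
    split_ifs
    · rw [zero_pow two_ne_zero]
      exact sq_nonneg _
    · refine le_of_eq ?_
      linear_combination (primalDiff M f (someEdge e)) ^ 2 * (τ * τ * hσ + hτ)

/-- A flow in the dual is induced by a potential on `G`. -/
theorem exists_potential_of_flow {s' t' : F} (hst' : M.dual.IsLink none s' t') (c : β → ℝ)
    (x : E(G) → Bool) (θ : DirEdge (dualGraph M) → ℝ)
    (hθ : IsUnitFlow (dualGraph M) ⟨s', Set.mem_univ s'⟩ ⟨t', Set.mem_univ t'⟩ θ)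
    (hx : ∀ d, x (dualEdgeEquiv M d.edge) = true → θ d = 0) :
    ∃ f : V(G) → ℝ, (f s - f t = 1 ∧ ∀ d : DirEdge G, x d.edge = true → f d.src = f d.tgt) ∧
      potentialEnergy G c f = 2 * flowEnergy (dualGraph M) (fun e => 1 / c e) θ := by
  classical
  obtain ⟨σ, hσ, hvert⟩ := primalDiff_noneEdge M
  obtain ⟨τ, hτ, hface⟩ := faceDiff_noneEdge M hst'
  -- The value -τ on the added edge cancels the net outflow at s' and t', so `y` sums to zero around
  -- every face boundary, counted with signs.
  let y : E(addEdge G s t) → ℝ := fun e =>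
    addEdgeEquiv.symm e |>.elim (-τ) fun e => θ (dualDir M ((dualEdgeEquiv M).symm e))
  have hy_none : y noneEdge = -τ := rfl
  have hy_some (e : E(G)) : y (someEdge e) = θ (dualDir M ((dualEdgeEquiv M).symm e)) := rfl
  obtain ⟨g, hg⟩ := M.exists_vertexDiff_eq y fun φ => by
    have h1 : ∑ e : E(G), θ (dualDir M ((dualEdgeEquiv M).symm e)) *
        M.faceDiff (fun ψ => if ψ = φ then 1 else 0) (someEdge e) =
        (if s' = φ then 1 else 0) - (if t' = φ then 1 else 0) := by
      rw [← outflow_dualGraph M hθ.antisymm ⟨φ, Set.mem_univ φ⟩, hθ.outflow]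
      simp only [Subtype.ext_iff, eq_comm (b := φ)]
    rw [sum_addEdge, hy_none, hface]
    simp only [hy_some]
    rw [h1]
    linear_combination -((if s' = φ then 1 else 0) - (if t' = φ then 1 else 0)) * hτ
  -- Across the added edge this gives σ(f(s) - f(t)) = (-στ)(-τ) = σ, the required normalisation.
  let f : V(G) → ℝ := fun v => -(σ * τ) * g ⟨v.1, v.2⟩
  have hf (e : E(addEdge G s t)) : primalDiff M f e = -(σ * τ) * y e := by
    rw [← hg]
    exact congrFun (map_smul M.vertexDiff (-(σ * τ)) g) e
  refine ⟨f, ⟨?_, ?_⟩, ?_⟩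
  · have h1 := hvert f
    rw [hf, hy_none] at h1
    linear_combination -σ * h1 + τ * τ * hσ + hτ - (f s - f t) * hσ
  · rw [primalDiff_someEdge_eq_zero_iff M]
    intro e he
    rw [hf, hy_some, hx (dualDir M ((dualEdgeEquiv M).symm e)) he, mul_zero]
  · rw [flowEnergy_dualGraph M c hθ.antisymm, potentialEnergy_eq M]
    congr 1
    refine Finset.sum_congr rfl fun e _ => ?_
    rw [hf, hy_some]
    linear_combination (c e * θ (dualDir M ((dualEdgeEquiv M).symm e)) ^ 2) * (τ * τ * hσ + hτ)

/-- The negative witness size is twice the effective resistance in the dual. -/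
theorem negSize_stProgram_eq_effRes (hst : s ≠ t) {s' t' : F} (hst' : M.dual.IsLink none s' t')
    (c : β → ℝ) (hc : ∀ e ∈ E(G), 0 < c e) (x : E(G) → Bool) :
    (stProgram G c s t hst).negSize x =
      2 * effRes (dualInputGraph M x) (fun e => 1 / c e)
        ⟨s', Set.mem_univ s'⟩ ⟨t', Set.mem_univ t'⟩ := by
  have hS (d : DirEdge (dualGraph M)) : (d.edge : β) ∉ {e | ∃ h : e ∈ E(G), x ⟨e, h⟩ = false} ↔
      x (dualEdgeEquiv M d.edge) = true := by
    have hd := (dualEdgeEquiv M d.edge).2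
    have : (d.edge : β) ∈ {e | ∃ h : e ∈ E(G), x ⟨e, h⟩ = false} ↔
        x (dualEdgeEquiv M d.edge) = false :=
      ⟨fun ⟨_, h⟩ => h, fun h => ⟨hd, h⟩⟩
    rw [this, Bool.not_eq_false]
  have htwo : (2 : ℝ≥0∞) = ENNReal.ofReal 2 := by simp
  rw [negSize_stProgram c hc]
  refine Eq.trans ?_ (congrArg (2 * ·) (effRes_restrict (G := dualGraph M) _ (fun e => 1 / c e)
    ⟨s', Set.mem_univ s'⟩ ⟨t', Set.mem_univ t'⟩).symm)
  simp only [hS]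
  rw [htwo, ENNReal.mul_iInf_of_ne (by simp) (by simp)]
  apply le_antisymm
  · refine le_iInf fun θ => ?_
    rw [ENNReal.mul_iInf_of_ne (by simp) (by simp)]
    refine le_iInf fun hθ => ?_
    obtain ⟨f, hf, he⟩ := exists_potential_of_flow M hst' c x θ hθ.1 hθ.2
    refine (iInf₂_le f hf).trans_eq ?_
    rw [he, ENNReal.ofReal_mul zero_le_two]
  · refine le_iInf₂ fun f hf => ?_
    obtain ⟨θ, hθ, hx, he⟩ := exists_flow_of_potential M hst' c hc x f hf.1 hf.2
    refine (iInf_le _ θ).trans ?_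
    rw [ENNReal.mul_iInf_of_ne (by simp) (by simp)]
    refine (iInf_le _ ⟨hθ, hx⟩).trans ?_
    rw [← ENNReal.ofReal_mul zero_le_two]
    exact ENNReal.ofReal_le_ofReal he

end Duality

end STConn

theorem mainTheorem2 {α β F : Type*} [Finite α] [Finite β] [Finite F]
    (G : Graph α β) (s t : V(G)) (hst : s ≠ t)
    (M : STConn.PlaneEmbedding (STConn.addEdge G s t) F)
    (s' t' : F) (hst' : M.dual.IsLink none s' t')
    (c : β → ℝ) (hc : ∀ e ∈ E(G), 0 < c e) (x : E(G) → Bool) :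
    (STConn.stProgram G c s t hst).posSize x =
        1 / 2 * STConn.effRes (STConn.inputGraph G x) c ⟨s.1, s.2⟩ ⟨t.1, t.2⟩ ∧
      (STConn.stProgram G c s t hst).negSize x =
        2 * STConn.effRes (STConn.dualInputGraph M x) (fun e => 1 / c e)
          ⟨s', Set.mem_univ s'⟩ ⟨t', Set.mem_univ t'⟩ :=
  ⟨STConn.posSize_stProgram c hc s t hst x, STConn.negSize_stProgram_eq_effRes M hst hst' c hc x⟩
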